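/- Let $A\in\mathbb R^{m\times n}$ and let $\mathbb R^n$ and $\mathbb R^m$ be endowed with arbitrary norms, both denoted $\|\cdot\|$. For $J\subseteq[m]=\{1,\dots,m\}$ let $A_J$ and $y_J$ denote the restrictions of $A$ and of $y\in\mathbb R^m$ to the rows, respectively entries, indexed by $J$. Let $$\mathcal S(A)=\{J\subseteq[m] : A_J(\mathbb R^n)+\mathbb R^J_+=\mathbb R^J\},\qquad H_J(A)=\max_{y\in\mathbb R^m,\ \|y\|\le 1}\ \min_{x\in\mathbb R^n,\ A_Jx\le y_J}\|x\|\quad(J\in\mathcal S(A)),$$ so that $H_\emptyset(A)=0$, and let $H(A)=\max_{J\in\mathcal S(A)}H_J(A)$. For $b\in\mathbb R^m$ let $P_A(b)=\{x\in\mathbb R^n: Ax\le b\}$ with the componentwise order, let $z_+=\max(0,z)$ componentwise, and let $\mathrm{dist}(\cdot,S)$ be the distance to a nonempty set $S$ in the norm of the respective space. Then all the minima and maxima in the definitions of $H_J(A)$, for $J\in\mathcal S(A)$, and of $H(A)$ are attained (the minima for every $y\in\mathbb R^m$), and for all $b\in A(\mathbb R^n)+\mathbb R^m_+$ and all $u\in\mathbb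 R^n$ the distance $\mathrm{dist}(u,P_A(b))$ is attained at a point of $P_A(b)$ and $$\mathrm{dist}(u,P_A(b))\le H(A)\cdot\mathrm{dist}(b-Au,\mathbb R^m_+)\le H(A)\cdot\|(Au-b)_+\|.$$ Furthermore, the first bound is tight: if $H(A)>0$, then there exist $b\in A(\mathbb R^n)+\mathbb R^m_+$ and $u\in\mathbb R^n$ such that $$\mathrm{dist}(u,P_A(b))=H(A)\cdot\mathrm{dist}(b-Au,\mathbb R^m_+)>0.$$ -/

import Mathlib

open scoped Matrix Pointwise

namespace Hoffman

variable {m n : ℕ}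

/-- The submatrix `A_J` of `A` formed by the rows with index in `J`. -/
def rows (A : Matrix (Fin m) (Fin n) ℝ) (J : Finset (Fin m)) : Matrix J (Fin n) ℝ :=
  A.submatrix (fun i : J => (i : Fin m)) id

/-- The subvector `y_J` of `y` formed by the entries with index in `J`. -/
def restr (y : Fin m → ℝ) (J : Finset (Fin m)) : J → ℝ := fun i => y i

/-- The collection `𝒮(A)` of all `J ⊆ [m]` with `A_J(ℝⁿ) + ℝ^J₊ = ℝ^J`. -/
def surjSets (A : Matrix (Fin m) (Fin n) ℝ) : Set (Finset (Fin m)) :=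
  {J | (Set.range fun x : Fin n → ℝ => rows A J *ᵥ x) + Set.Ici (0 : J → ℝ) = Set.univ}

/-- The polyhedron `P_A(b) = {x : A x ≤ b}` (componentwise order). -/
def poly (A : Matrix (Fin m) (Fin n) ℝ) (b : Fin m → ℝ) : Set (Fin n → ℝ) :=
  {x | A *ᵥ x ≤ b}

/-- The polyhedron `{x : A_J x ≤ y_J}`. -/
def subPoly (A : Matrix (Fin m) (Fin n) ℝ) (J : Finset (Fin m)) (y : Fin m → ℝ) :
    Set (Fin n → ℝ) :=
  {x | rows A J *ᵥ x ≤ restr y J}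

/-- The distance from `u` to the set `S` in the norm `N` on `ℝᵈ`. -/
noncomputable def dist {d : ℕ} (N : Seminorm ℝ (Fin d → ℝ)) (u : Fin d → ℝ)
    (S : Set (Fin d → ℝ)) : ℝ :=
  sInf ((fun x => N (u - x)) '' S)

/-- The inner minimum `min {‖x‖ : A_J x ≤ y_J}`, with `N` the norm on `ℝⁿ`. -/
noncomputable def minNorm (A : Matrix (Fin m) (Fin n) ℝ) (N : Seminorm ℝ (Fin n → ℝ))
    (J : Finset (Fin m)) (y : Fin m → ℝ) : ℝ :=
  sInf (N '' subPoly A J y)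

/-- The constant `H_J(A) = max_{‖y‖ ≤ 1} min {‖x‖ : A_J x ≤ y_J}`, with `N` the norm on `ℝⁿ`
and `M` the norm on `ℝᵐ`. For `J = ∅` the formula gives `0`, see `HJ_empty`. -/
noncomputable def HJ (A : Matrix (Fin m) (Fin n) ℝ) (N : Seminorm ℝ (Fin n → ℝ))
    (M : Seminorm ℝ (Fin m → ℝ)) (J : Finset (Fin m)) : ℝ :=
  sSup (minNorm A N J '' {y | M y ≤ 1})

/-- The Hoffman constant `H(A) = max_{J ∈ 𝒮(A)} H_J(A)`. -/
noncomputable def H (A : Matrix (Fin m) (Fin n) ℝ) (N : Seminorm ℝ (Fin n → ℝ))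
    (M : Seminorm ℝ (Fin m → ℝ)) : ℝ :=
  sSup (HJ A N M '' surjSets A)

/-- The convention `H_∅(A) = 0` is what the general formula gives. -/
theorem HJ_empty (A : Matrix (Fin m) (Fin n) ℝ) (N : Seminorm ℝ (Fin n → ℝ))
    (M : Seminorm ℝ (Fin m → ℝ)) : HJ A N M ∅ = 0 := by
  have h : ∀ y, minNorm A N ∅ y = 0 := by
    intro y
    refine le_antisymm (csInf_le ⟨0, ?_⟩ ⟨0, ?_, map_zero N⟩) (Real.sInf_nonneg ?_)
    · rintro _ ⟨x, -, rfl⟩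
      exact apply_nonneg N x
    · intro i
      exact absurd i.2 (Finset.notMem_empty _)
    · rintro _ ⟨x, -, rfl⟩
      exact apply_nonneg N x
  have h' : minNorm A N ∅ '' {y | M y ≤ 1} = {0} := by
    ext t
    constructor
    · rintro ⟨y, -, rfl⟩
      exact h y
    · rintro rfl
      exact ⟨0, by simp, h 0⟩
  rw [HJ, h', csSup_singleton]

end Hoffman

/-! Translate by `u` and put `e = b - A u`, `y = e - s` with `s` a nearest point of the orthant; the
bound asks for a solution of `A z ≤ e` in the ball of radius `H(A)‖y‖`. Relax the radius and `e` by
`ε`. If the relaxed ball missed the strict system, separation would give multipliers `v ≥ 0`, `v ≠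
0`, certifying this. While the support of `v` is outside `𝒮(A)`, Gordan's alternative supplies `w ≥
0` on it with `wᵀA = 0`, and subtracting a multiple of `w` shrinks the support and keeps the
certificate (`exists_surjSets_infeasible`). So some `J ∈ 𝒮(A)` is already infeasible on the ball,
but a least-norm solution of `A_J x ≤ y_J` lies there: contradiction. Compactness lets `ε → 0`. -/

namespace Hoffman

/-! ### Norms on `ℝᵈ`: compactness and nearest points -/

section Norms

variable {d : ℕ} {N : Seminorm ℝ (Fin d → ℝ)}

theorem seminorm_continuous (N : Seminorm ℝ (Fin d → ℝ)) : Continuous N :=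
  continuousOn_univ.1 (N.convexOn.continuousOn isOpen_univ)

theorem exists_pos_mul_norm_le (hN : ∀ x, N x = 0 → x = 0) :
    ∃ c > 0, ∀ x, c * ‖x‖ ≤ N x := by
  rcases (Metric.sphere (0 : Fin d → ℝ) 1).eq_empty_or_nonempty with h | h
  -- The unit sphere is empty only when the space is trivial.
  · refine ⟨1, one_pos, fun x => ?_⟩
    have hx : x = 0 := by
      by_contra hx
      have : (‖x‖⁻¹ • x) ∈ Metric.sphere (0 : Fin d → ℝ) 1 := by
        rw [mem_sphere_zero_iff_norm, norm_smul, norm_inv, norm_norm,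
          inv_mul_cancel₀ (norm_ne_zero_iff.2 hx)]
      simp [h] at this
    simp [hx]
  · obtain ⟨x₀, hx₀, hmin⟩ := (isCompact_sphere (0 : Fin d → ℝ) 1).exists_isMinOn h
      (seminorm_continuous N).continuousOn
    have hpos : 0 < N x₀ := by
      refine lt_of_le_of_ne (apply_nonneg N _) fun h0 => ?_
      rw [hN x₀ h0.symm] at hx₀
      simp at hx₀
    refine ⟨N x₀, hpos, fun x => ?_⟩
    rcases eq_or_ne x 0 with rfl | hx
    · simp
    have hx' : 0 < ‖x‖ := norm_pos_iff.2 hx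
    have hm : (‖x‖⁻¹ • x) ∈ Metric.sphere (0 : Fin d → ℝ) 1 := by
      rw [mem_sphere_zero_iff_norm, norm_smul, norm_inv, norm_norm, inv_mul_cancel₀ hx'.ne']
    have h1 : N x₀ ≤ N (‖x‖⁻¹ • x) := hmin hm
    rw [map_smul_eq_mul, norm_inv, norm_norm, inv_mul_eq_div, le_div_iff₀ hx'] at h1
    exact h1

theorem isCompact_sublevel (hN : ∀ x, N x = 0 → x = 0) (r : ℝ) : IsCompact {x | N x ≤ r} := by
  obtain ⟨c, hc, h⟩ := exists_pos_mul_norm_le hN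
  refine (isCompact_closedBall (0 : Fin d → ℝ) (r / c)).of_isClosed_subset
    (isClosed_le (seminorm_continuous N) continuous_const) fun x hx => ?_
  rw [mem_closedBall_zero_iff, le_div_iff₀ hc, mul_comm]
  exact (h x).trans hx

theorem dist_le {u x : Fin d → ℝ} {S : Set (Fin d → ℝ)} (hx : x ∈ S) : dist N u S ≤ N (u - x) :=
  csInf_le ⟨0, by rintro _ ⟨x, -, rfl⟩; exact apply_nonneg N _⟩ ⟨x, hx, rfl⟩

theorem exists_eq_dist (hN : ∀ x, N x = 0 → x = 0) {S : Set (Fin d → ℝ)} (hS : IsClosed S)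
    (hne : S.Nonempty) (u : Fin d → ℝ) : ∃ x ∈ S, N (u - x) = dist N u S := by
  obtain ⟨x₁, hx₁⟩ := hne
  have hcont : Continuous fun x => N (u - x) := (seminorm_continuous N).comp (by fun_prop)
  have hcomp : IsCompact (S ∩ {x | N (u - x) ≤ N (u - x₁)}) := by
    have := (isCompact_sublevel hN (N (u - x₁))).image (f := fun z => u - z) (by fun_prop)
    refine this.of_isClosed_subset (hS.inter (isClosed_le hcont continuous_const)) ?_
    rintro x ⟨-, hx⟩
    exact ⟨u - x, hx, by simp⟩
  obtain ⟨x, hx, hmin⟩ := hcomp.exists_isMinOn ⟨x₁, hx₁, Set.mem_ofPred.2 le_rfl⟩ hcont.continuousOn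
  refine ⟨x, hx.1, le_antisymm (le_csInf ⟨_, x₁, hx₁, rfl⟩ ?_) (dist_le hx.1)⟩
  rintro _ ⟨z, hz, rfl⟩
  by_cases hz' : N (u - z) ≤ N (u - x₁)
  · exact hmin (show z ∈ _ from ⟨hz, hz'⟩)
  · exact le_trans hx.2 (not_le.1 hz').le

end Norms

/-! ### Separation for strict inequality systems -/

section Separation

theorem nonneg_of_forall_pos_add_mul {a c : ℝ} (h : ∀ ε > 0, 0 < a + ε * c) : 0 ≤ a := by
  have ht : Filter.Tendsto (fun ε : ℝ => a + ε * c) (nhdsWithin 0 (Set.Ioi 0)) (nhds a) := by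
    have : Continuous fun ε : ℝ => a + ε * c := by fun_prop
    simpa using (this.tendsto 0).mono_left nhdsWithin_le_nhds
  exact ge_of_tendsto ht (Filter.eventually_of_mem self_mem_nhdsWithin fun ε hε => (h ε hε).le)

/-- If no point of a convex set satisfies the strict system `f z < e`, then a nonzero nonnegative
combination of its inequalities fails on the whole set. -/
theorem exists_nonneg_separation {ι E : Type*} [Fintype ι] [AddCommGroup E] [Module ℝ E]
    {C : Set E} (hC : Convex ℝ C) (hne : C.Nonempty) (f : E →ₗ[ℝ] ι → ℝ) (e : ι → ℝ)
    (h : ∀ z ∈ C, ∃ i, e i ≤ f z i) :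
    ∃ v : ι → ℝ, 0 ≤ v ∧ v ≠ 0 ∧ ∀ z ∈ C, v ⬝ᵥ e ≤ v ⬝ᵥ f z := by
  classical
  -- The upward closure makes `K` open, and forces a functional positive on `K` to have nonnegative
  -- coefficients.
  set K : Set (ι → ℝ) := {t | ∃ z ∈ C, ∀ i, f z i - e i < t i} with hK
  have hKo : IsOpen K := by
    have : K = ⋃ z ∈ C, Set.pi Set.univ fun i => Set.Ioi (f z i - e i) := by
      ext t
      simp [hK]
    rw [this]
    exact isOpen_biUnion fun z _ => isOpen_set_pi Set.finite_univ fun i _ => isOpen_Ioi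
  have hKc : Convex ℝ K := by
    rintro s ⟨z, hz, hs⟩ t ⟨w, hw, ht⟩ a b ha hb hab
    refine ⟨a • z + b • w, hC hz hw ha hb hab, fun i => ?_⟩
    simp only [map_add, map_smul, Pi.add_apply, Pi.smul_apply, smul_eq_mul]
    have h1 := hs i
    have h2 := ht i
    have h3 : e i = a * e i + b * e i := by rw [← add_mul, hab, one_mul]
    rcases ha.eq_or_lt with rfl | ha
    · obtain rfl : b = 1 := by linarith
      linarith
    · nlinarith
  have h0 : (0 : ι → ℝ) ∉ K := by
    rintro ⟨z, hz, h'⟩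
    obtain ⟨i, hi⟩ := h z hz
    have := h' i
    simp only [Pi.zero_apply] at this
    linarith
  obtain ⟨g, hg⟩ := geometric_hahn_banach_point_open hKc hKo h0
  simp only [map_zero] at hg
  set v : ι → ℝ := fun i => g (Pi.single i 1) with hv
  have hgv : ∀ t, g t = v ⬝ᵥ t := by
    intro t
    have := LinearMap.pi_apply_eq_sum_univ (g : (ι → ℝ) →ₗ[ℝ] ℝ) t
    simp only [ContinuousLinearMap.coe_coe, smul_eq_mul] at this
    rw [this, dotProduct]
    refine Finset.sum_congr rfl fun i _ => ?_
    rw [mul_comm, hv]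
    congr 2
    ext j
    simp [Pi.single_apply, eq_comm]
  obtain ⟨z₀, hz₀⟩ := hne
  have hadd : ∀ z ∈ C, ∀ ε : ℝ, 0 < ε → ∀ s : ι → ℝ, 0 ≤ s → 0 < g (f z - e + ε • 1 + s) := by
    intro z hz ε hε s hs
    refine hg _ ⟨z, hz, fun i => ?_⟩
    have := hs i
    simp only [Pi.add_apply, Pi.sub_apply, Pi.smul_apply, Pi.one_apply, smul_eq_mul, mul_one,
      Pi.zero_apply] at this ⊢
    linarith
  refine ⟨v, fun i => ?_, ?_, fun z hz => ?_⟩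
  -- Go far along the `i`-th axis inside `K`, by `ε⁻¹`, and rescale by `ε`.
  · refine nonneg_of_forall_pos_add_mul (c := g (f z₀ - e + (1 : ℝ) • 1)) fun ε hε => ?_
    have := hadd z₀ hz₀ 1 one_pos (ε⁻¹ • Pi.single i 1)
      (smul_nonneg (inv_nonneg.2 hε.le) (Pi.single_nonneg.2 zero_le_one))
    rw [map_add, map_smul, smul_eq_mul] at this
    have h2 := mul_pos hε this
    rw [mul_add, mul_inv_cancel_left₀ hε.ne'] at h2
    rw [add_comm]
    exact h2
  · intro hv0
    have := hadd z₀ hz₀ 1 one_pos 0 le_rfl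
    rw [hgv, hv0, zero_dotProduct] at this
    exact lt_irrefl _ this
  · have : 0 ≤ g (f z - e) := by
      refine nonneg_of_forall_pos_add_mul (c := g 1) fun ε hε => ?_
      have := hadd z hz ε hε 0 le_rfl
      rwa [add_zero, map_add, map_smul, smul_eq_mul] at this
    rw [hgv, dotProduct_sub] at this
    linarith

end Separation

/-! ### The collection `𝒮(A)` and infeasible subsystems -/

variable {m n : ℕ} {A : Matrix (Fin m) (Fin n) ℝ} {J : Finset (Fin m)}

theorem mem_subPoly {y : Fin m → ℝ} {x : Fin n → ℝ} :
    x ∈ subPoly A J y ↔ ∀ i ∈ J, (A *ᵥ x) i ≤ y i :=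
  ⟨fun h i hi => h ⟨i, hi⟩, fun h i => h i i.2⟩

theorem isClosed_subPoly (y : Fin m → ℝ) : IsClosed (subPoly A J y) :=
  isClosed_le (Continuous.matrix_mulVec continuous_const continuous_id) continuous_const

theorem isClosed_poly (b : Fin m → ℝ) : IsClosed (poly A b) :=
  isClosed_le (Continuous.matrix_mulVec continuous_const continuous_id) continuous_const

theorem subPoly_nonempty (hJ : J ∈ surjSets A) (y : Fin m → ℝ) : (subPoly A J y).Nonempty := by
  have h : restr y J ∈ (Set.range fun x : Fin n → ℝ => rows A J *ᵥ x) + Set.Ici (0 : J → ℝ) := by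
    rw [show _ = _ from hJ]
    trivial
  obtain ⟨_, ⟨x, rfl⟩, s, hs, h⟩ := h
  refine ⟨x, ?_⟩
  change rows A J *ᵥ x ≤ restr y J
  rw [← h]
  exact le_add_of_nonneg_right hs

theorem poly_nonempty {b : Fin m → ℝ}
    (hb : b ∈ (Set.range fun x : Fin n → ℝ => A *ᵥ x) + Set.Ici (0 : Fin m → ℝ)) :
    (poly A b).Nonempty := by
  obtain ⟨_, ⟨x, rfl⟩, s, hs, rfl⟩ := hb
  exact ⟨x, Set.mem_ofPred.2 (le_add_of_nonneg_right hs)⟩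

/-- A large multiple of `z` pushes all rows in `J` below any target. -/
theorem mem_surjSets_of_neg {z : Fin n → ℝ} (hz : ∀ i ∈ J, (A *ᵥ z) i < 0) :
    J ∈ surjSets A := by
  refine Set.eq_univ_of_forall fun t => ?_
  have h : ∀ i : J, ∀ᶠ k : ℝ in Filter.atTop, k * (A *ᵥ z) i ≤ t i := fun i =>
    (Filter.tendsto_id.atTop_mul_const_of_neg (hz i i.2)).eventually_le_atBot (t i)
  obtain ⟨k, hk⟩ := (Filter.eventually_all.2 h).exists
  refine ⟨_, ⟨k • z, rfl⟩, t - rows A J *ᵥ (k • z), ?_, by simp⟩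
  rw [Set.mem_Ici, sub_nonneg, Matrix.mulVec_smul]
  exact hk

/-- Gordan's alternative for `J ∉ 𝒮(A)`. -/
theorem exists_dual_of_notMem_surjSets (hJ : J ∉ surjSets A) :
    ∃ w : Fin m → ℝ, 0 ≤ w ∧ w ≠ 0 ∧ (∀ i ∉ J, w i = 0) ∧ ∀ z, w ⬝ᵥ (A *ᵥ z) = 0 := by
  obtain ⟨v, hv, hv0, h⟩ := exists_nonneg_separation (convex_univ (𝕜 := ℝ) (E := Fin n → ℝ))
    Set.univ_nonempty (rows A J).mulVecLin 0 fun z _ => by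
      by_contra! hc
      exact hJ (mem_surjSets_of_neg fun i hi => hc ⟨i, hi⟩)
  have hz : ∀ z, 0 ≤ v ⬝ᵥ (rows A J *ᵥ z) := fun z => by simpa using h z trivial
  refine ⟨fun i => if hi : i ∈ J then v ⟨i, hi⟩ else 0, fun i => ?_, fun h0 => hv0 ?_,
    fun i hi => by simp [hi], fun z => ?_⟩
  · by_cases hi : i ∈ J
    · simpa [hi] using hv ⟨i, hi⟩
    · simp [hi]
  · ext i
    simpa using congrFun h0 i
  · have h1 : v ⬝ᵥ (rows A J *ᵥ z) = 0 := by
      have h2 := hz (-z)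
      rw [Matrix.mulVec_neg, dotProduct_neg] at h2
      linarith [hz z]
    refine Eq.trans ?_ h1
    rw [dotProduct, dotProduct, ← Finset.sum_subset (Finset.subset_univ J),
      ← Finset.sum_coe_sort]
    · refine Finset.sum_congr rfl fun i _ => ?_
      simp only [i.2, dite_true]
      rfl
    · intro i _ hi
      simp [hi]

/-- If a strictly feasible system `A z < e` has no strict solution in a convex set `C`, then
already the rows indexed by some `J ∈ 𝒮(A)` have none. -/
theorem exists_surjSets_infeasible {C : Set (Fin n → ℝ)} (hC : Convex ℝ C) (hne : C.Nonempty)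
    {e : Fin m → ℝ} {z₀ : Fin n → ℝ} (hz₀ : ∀ i, (A *ᵥ z₀) i < e i)
    (h : ∀ z ∈ C, ∃ i, e i ≤ (A *ᵥ z) i) :
    ∃ J ∈ surjSets A, ∀ z ∈ C, ∃ i ∈ J, e i ≤ (A *ᵥ z) i := by
  classical
  -- Strong induction on the support size of the certificate `v`.
  suffices key : ∀ k : ℕ, ∀ v : Fin m → ℝ, (Finset.univ.filter fun i => v i ≠ 0).card = k →
      0 ≤ v → v ≠ 0 → (∀ z ∈ C, v ⬝ᵥ e ≤ v ⬝ᵥ (A *ᵥ z)) →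
      ∃ J ∈ surjSets A, ∀ z ∈ C, ∃ i ∈ J, e i ≤ (A *ᵥ z) i by
    obtain ⟨v, hv, hv0, hvC⟩ := exists_nonneg_separation hC hne A.mulVecLin e h
    exact key _ v rfl hv hv0 hvC
  intro k
  induction k using Nat.strong_induction_on with
  | _ k ih =>
  intro v hk hv hv0 hvC
  by_cases hJ : (Finset.univ.filter fun i => v i ≠ 0) ∈ surjSets A
  · refine ⟨_, hJ, fun z hz => ?_⟩
    by_contra! hc
    obtain ⟨i, hi⟩ := Function.ne_iff.1 hv0
    refine (hvC z hz).not_gt (Finset.sum_lt_sum (fun j _ => ?_) ⟨i, Finset.mem_univ _, ?_⟩)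
    · by_cases hj : v j = 0
      · simp [hj]
      · exact mul_le_mul_of_nonneg_left (hc j (by simpa using hj)).le (hv j)
    · exact mul_lt_mul_of_pos_left (hc i (by simpa using hi)) (lt_of_le_of_ne (hv i) (Ne.symm hi))
  obtain ⟨w, hw, hw0, hwJ, hwA⟩ := exists_dual_of_notMem_surjSets hJ
  have hwv : ∀ i, w i ≠ 0 → v i ≠ 0 := fun i hi hvi => hi (hwJ i (by simpa using hvi))
  -- Strict feasibility of `z₀` enters only here; it makes the inequality for `v - t • w` strict,
  -- hence `v - t • w ≠ 0`.
  have hwe : 0 < w ⬝ᵥ e := by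
    rw [← hwA z₀]
    obtain ⟨i, hi⟩ := Function.ne_iff.1 hw0
    exact Finset.sum_lt_sum (fun j _ => mul_le_mul_of_nonneg_left (hz₀ j).le (hw j))
      ⟨i, Finset.mem_univ _, mul_lt_mul_of_pos_left (hz₀ i) (lt_of_le_of_ne (hw i) (Ne.symm hi))⟩
  have hsne : (Finset.univ.filter fun i => w i ≠ 0).Nonempty := by
    obtain ⟨i, hi⟩ := Function.ne_iff.1 hw0
    exact ⟨i, by simpa using hi⟩
  obtain ⟨i₀, hi₀, hmin⟩ := Finset.exists_min_image _ (fun i => v i / w i) hsne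
  have hi₀ : w i₀ ≠ 0 := by simpa using hi₀
  have hpos : ∀ i, w i ≠ 0 → 0 < w i := fun i hi => lt_of_le_of_ne (hw i) (Ne.symm hi)
  -- The largest step keeping `v - t • w` nonnegative; it kills coordinate `i₀`.
  set t := v i₀ / w i₀ with ht
  have htpos : 0 < t :=
    div_pos (lt_of_le_of_ne (hv i₀) (Ne.symm (hwv i₀ hi₀))) (hpos i₀ hi₀)
  have hlt : ∀ z ∈ C, (v - t • w) ⬝ᵥ e < (v - t • w) ⬝ᵥ (A *ᵥ z) := by
    intro z hz
    rw [sub_dotProduct, sub_dotProduct, smul_dotProduct, smul_dotProduct, hwA, smul_zero, sub_zero,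
      smul_eq_mul]
    have := hvC z hz
    have := mul_pos htpos hwe
    linarith
  refine ih _ ?_ (v - t • w) rfl ?_ ?_ fun z hz => (hlt z hz).le
  · rw [← hk]
    refine Finset.card_lt_card (Finset.ssubset_iff_of_subset ?_ |>.2 ⟨i₀, ?_, ?_⟩)
    · intro i
      simp only [Finset.mem_filter, Finset.mem_univ, true_and]
      intro hi hvi
      refine hi ?_
      have : w i = 0 := by
        by_contra hwi
        exact hwv i hwi hvi
      simp [hvi, this]
    · simpa using hwv i₀ hi₀
    · simp [ht, div_mul_cancel₀ _ hi₀]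
  · intro i
    by_cases hwi : w i = 0
    · simpa [hwi] using hv i
    · have := hmin i (by simpa using hwi)
      rw [le_div_iff₀ (hpos i hwi)] at this
      simpa using this
  · intro h0
    obtain ⟨z, hz⟩ := hne
    have := hlt z hz
    simp [h0] at this

/-! ### The constants `H_J(A)` and `H(A)`, the error bound and its tightness -/

section Constants

variable {N : Seminorm ℝ (Fin n → ℝ)} {M : Seminorm ℝ (Fin m → ℝ)}

theorem minNorm_le {y : Fin m → ℝ} {x : Fin n → ℝ} (hx : x ∈ subPoly A J y) :
    minNorm A N J y ≤ N x :=
  csInf_le ⟨0, by rintro _ ⟨x, -, rfl⟩; exact apply_nonneg N _⟩ ⟨x, hx, rfl⟩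

theorem exists_eq_minNorm (hN : ∀ x, N x = 0 → x = 0) (hJ : J ∈ surjSets A) (y : Fin m → ℝ) :
    ∃ x ∈ subPoly A J y, N x = minNorm A N J y := by
  obtain ⟨x, hx, h⟩ := exists_eq_dist hN (isClosed_subPoly y) (subPoly_nonempty hJ y) 0
  refine ⟨x, hx, ?_⟩
  simpa [dist, minNorm] using h

/-- If `A_J x₀ ≤ -1`, adding `‖y - y'‖ • x₀` to a solution for `y'` gives one for `y`, so `N x₀` is
a Lipschitz constant for the sup norm. -/
theorem continuous_minNorm (hN : ∀ x, N x = 0 → x = 0) (hJ : J ∈ surjSets A) :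
    Continuous (minNorm A N J) := by
  obtain ⟨x₀, hx₀⟩ := subPoly_nonempty hJ (fun _ => -1)
  rw [mem_subPoly] at hx₀
  refine (LipschitzWith.of_le_add_mul ⟨N x₀, apply_nonneg N x₀⟩ fun y y' => ?_).continuous
  obtain ⟨x, hx, hxN⟩ := exists_eq_minNorm hN hJ y'
  rw [mem_subPoly] at hx
  have hmem : x + ‖y - y'‖ • x₀ ∈ subPoly A J y := by
    rw [mem_subPoly]
    intro i hi
    have h1 := hx i hi
    have h2 := mul_le_mul_of_nonneg_left (hx₀ i hi) (norm_nonneg (y - y'))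
    have h3 := neg_le_of_abs_le (norm_le_pi_norm (y - y') i)
    simp only [Pi.sub_apply] at h3
    simp only [Matrix.mulVec_add, Matrix.mulVec_smul, Pi.add_apply, Pi.smul_apply, smul_eq_mul]
    linarith
  refine (minNorm_le hmem).trans ((map_add_le_add N _ _).trans ?_)
  rw [map_smul_eq_mul, norm_norm, hxN, dist_eq_norm, mul_comm]
  rfl

theorem isGreatest_HJ (hN : ∀ x, N x = 0 → x = 0) (hM : ∀ y, M y = 0 → y = 0)
    (hJ : J ∈ surjSets A) : IsGreatest (minNorm A N J '' {y | M y ≤ 1}) (HJ A N M J) :=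
  ((isCompact_sublevel hM 1).image (continuous_minNorm hN hJ)).isGreatest_sSup
    ⟨_, 0, by simp, rfl⟩

theorem empty_mem_surjSets : (∅ : Finset (Fin m)) ∈ surjSets A :=
  mem_surjSets_of_neg (z := 0) fun i hi => absurd hi (Finset.notMem_empty i)

theorem isGreatest_H : IsGreatest (HJ A N M '' surjSets A) (H A N M) := by
  have hf : (HJ A N M '' surjSets A).Finite := (Set.toFinite _).image _
  have hne : (HJ A N M '' surjSets A).Nonempty := ⟨_, ∅, empty_mem_surjSets, rfl⟩
  exact ⟨hne.csSup_mem hf, fun t ht => le_csSup hf.bddAbove ht⟩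

theorem H_nonneg : 0 ≤ H A N M :=
  isGreatest_H.2 ⟨∅, empty_mem_surjSets, HJ_empty A N M⟩

theorem minNorm_le_HJ_mul (hN : ∀ x, N x = 0 → x = 0) (hM : ∀ y, M y = 0 → y = 0)
    (hJ : J ∈ surjSets A) (y : Fin m → ℝ) : minNorm A N J y ≤ HJ A N M J * M y := by
  rcases eq_or_ne (M y) 0 with h0 | h0
  · have : (0 : Fin n → ℝ) ∈ subPoly A J y := by
      rw [mem_subPoly, hM y h0]
      simp
    simpa [h0] using minNorm_le (N := N) this
  have hpos : 0 < M y := lt_of_le_of_ne (apply_nonneg M y) (Ne.symm h0)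
  obtain ⟨x, hx, hxN⟩ := exists_eq_minNorm hN hJ ((M y)⁻¹ • y)
  have h1 : N x ≤ HJ A N M J := by
    rw [hxN]
    refine (isGreatest_HJ hN hM hJ).2 ⟨_, ?_, rfl⟩
    rw [Set.mem_ofPred_eq, map_smul_eq_mul, norm_inv, Real.norm_of_nonneg hpos.le,
      inv_mul_cancel₀ h0]
  have h2 : M y • x ∈ subPoly A J y := by
    rw [mem_subPoly] at hx ⊢
    intro i hi
    have := mul_le_mul_of_nonneg_left (hx i hi) hpos.le
    rw [Pi.smul_apply, smul_eq_mul, mul_inv_cancel_left₀ h0] at this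
    rwa [Matrix.mulVec_smul]
  refine (minNorm_le h2).trans ?_
  rw [map_smul_eq_mul, Real.norm_of_nonneg hpos.le, mul_comm]
  exact mul_le_mul_of_nonneg_right h1 hpos.le

/-- A feasible system `A z ≤ e` has approximate solutions almost as short as the Hoffman constant
predicts from any `y ≤ e`. -/
theorem exists_approx_solution (hN : ∀ x, N x = 0 → x = 0) (hM : ∀ y, M y = 0 → y = 0)
    {e y : Fin m → ℝ} (he : (poly A e).Nonempty) (hy : y ≤ e) {ε : ℝ} (hε : 0 < ε) :
    ∃ z, N z ≤ H A N M * M y + ε ∧ ∀ i, (A *ᵥ z) i ≤ e i + ε := by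
  by_contra! hc
  obtain ⟨z₀, hz₀⟩ := he
  have hh : 0 ≤ H A N M * M y := mul_nonneg H_nonneg (apply_nonneg M y)
  obtain ⟨J, hJ, hJC⟩ := exists_surjSets_infeasible (A := A)
    (C := {z | N z ≤ H A N M * M y + ε})
    (by simpa using N.convexOn.convex_le (H A N M * M y + ε))
    ⟨0, by simpa using add_nonneg hh hε.le⟩ (e := fun i => e i + ε) (z₀ := z₀)
    (fun i => lt_of_le_of_lt (hz₀ i) (lt_add_of_pos_right _ hε))
    fun z hz => (hc z hz).imp fun _ => le_of_lt
  obtain ⟨x, hx, hxN⟩ := exists_eq_minNorm hN hJ y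
  have h1 : N x ≤ H A N M * M y := by
    rw [hxN]
    exact (minNorm_le_HJ_mul hN hM hJ y).trans
      (mul_le_mul_of_nonneg_right (isGreatest_H.2 ⟨J, hJ, rfl⟩) (apply_nonneg M y))
  -- On `J`, `A x ≤ y ≤ e < e + ε`, against infeasibility on the ball.
  obtain ⟨i, hi, hle⟩ := hJC x (by simp only [Set.mem_ofPred_eq]; linarith)
  have h2 := mem_subPoly.1 hx i hi
  have h3 := hy i
  linarith

theorem exists_solution (hN : ∀ x, N x = 0 → x = 0) (hM : ∀ y, M y = 0 → y = 0)
    {e y : Fin m → ℝ} (he : (poly A e).Nonempty) (hy : y ≤ e) :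
    ∃ z ∈ poly A e, N z ≤ H A N M * M y := by
  set h := H A N M * M y with hh
  have hA : ∀ i, Continuous fun z : Fin n → ℝ => (A *ᵥ z) i := fun i =>
    (continuous_apply i).comp (Continuous.matrix_mulVec continuous_const continuous_id)
  -- Nested nonempty compact sets of approximate solutions with `ε = 1 / (k + 1)`.
  let K : ℕ → Set (Fin n → ℝ) := fun k =>
    {z | N z ≤ h + 1 / ((k : ℝ) + 1)} ∩ ⋂ i, {z | (A *ᵥ z) i ≤ e i + 1 / ((k : ℝ) + 1)}
  have hclosed : ∀ k, IsClosed (K k) := fun k =>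
    (isClosed_le (seminorm_continuous N) continuous_const).inter
      (isClosed_iInter fun i => isClosed_le (hA i) continuous_const)
  obtain ⟨z, hz⟩ := IsCompact.nonempty_iInter_of_sequence_nonempty_isCompact_isClosed K
    (fun k z hz => by
      have h1 : 1 / (((k + 1 : ℕ) : ℝ) + 1) ≤ 1 / ((k : ℝ) + 1) :=
        one_div_le_one_div_of_le (by positivity) (by push_cast; linarith)
      have h3 : N z ≤ h + 1 / (((k + 1 : ℕ) : ℝ) + 1) := hz.1
      refine ⟨h3.trans (by linarith), Set.mem_iInter.2 fun i => ?_⟩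
      have h2 := Set.mem_ofPred.1 (Set.mem_iInter.1 hz.2 i)
      exact h2.trans (by linarith))
    (fun k => by
      obtain ⟨z, h1, h2⟩ := exists_approx_solution hN hM he hy (Nat.one_div_pos_of_nat (n := k))
      exact ⟨z, h1, Set.mem_iInter.2 h2⟩)
    ((isCompact_sublevel hN _).of_isClosed_subset (hclosed 0) Set.inter_subset_left) hclosed
  have hz' := Set.mem_iInter.1 hz
  have hlim : ∀ a : ℝ, Filter.Tendsto (fun k : ℕ => a + 1 / ((k : ℝ) + 1)) Filter.atTop (nhds a) :=
    fun a => by simpa using tendsto_const_nhds.add (tendsto_one_div_add_atTop_nhds_zero_nat (𝕜 := ℝ))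
  exact ⟨z, fun i => ge_of_tendsto' (hlim _) fun k => Set.mem_iInter.1 (hz' k).2 i,
    ge_of_tendsto' (hlim _) fun k => (hz' k).1⟩

theorem dist_poly_le (hN : ∀ x, N x = 0 → x = 0) (hM : ∀ y, M y = 0 → y = 0)
    {b : Fin m → ℝ} (hb : (poly A b).Nonempty) (u : Fin n → ℝ) :
    dist N u (poly A b) ≤ H A N M * dist M (b - A *ᵥ u) (Set.Ici 0) := by
  obtain ⟨s, hs, hsM⟩ := exists_eq_dist hM isClosed_Ici ⟨0, Set.self_mem_Ici⟩ (b - A *ᵥ u)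
  obtain ⟨x, hx⟩ := hb
  have hne : (poly A (b - A *ᵥ u)).Nonempty := ⟨x - u, fun i => by
    rw [Matrix.mulVec_sub]
    exact sub_le_sub_right (hx i) _⟩
  obtain ⟨z, hz, hzN⟩ := exists_solution hN hM hne (y := b - A *ᵥ u - s)
    (sub_le_self _ hs)
  have hmem : u + z ∈ poly A b := fun i => by
    have := hz i
    rw [Pi.sub_apply] at this
    rw [Matrix.mulVec_add, Pi.add_apply]
    linarith
  rw [← hsM]
  refine (dist_le hmem).trans ?_
  simpa using hzN

theorem dist_nonneg_orthant_le (M : Seminorm ℝ (Fin m → ℝ)) (y : Fin m → ℝ) :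
    dist M (-y) (Set.Ici 0) ≤ M y⁺ := by
  have h : -y + y⁺ ∈ Set.Ici (0 : Fin m → ℝ) := by
    rw [Set.mem_Ici, neg_add_eq_sub, sub_nonneg]
    exact le_posPart y
  refine (dist_le h).trans ?_
  rw [sub_add_cancel_left, map_neg_eq_map]

/-- Take `u = 0` and `J`, `y` attaining `H(A)`. If `b` agrees with `y` on `J`, then `P_A(b)` lies in
`{x : A_J x ≤ y_J}`, so its distance from `0` is at least `H(A)`. -/
theorem exists_tight (hN : ∀ x, N x = 0 → x = 0) (hM : ∀ y, M y = 0 → y = 0)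
    (hH : 0 < H A N M) :
    ∃ b ∈ (Set.range fun x : Fin n → ℝ => A *ᵥ x) + Set.Ici (0 : Fin m → ℝ),
      ∃ u : Fin n → ℝ,
        dist N u (poly A b) = H A N M * dist M (b - A *ᵥ u) (Set.Ici 0) ∧
        0 < H A N M * dist M (b - A *ᵥ u) (Set.Ici 0) := by
  classical
  obtain ⟨J, hJ, hJH⟩ := (isGreatest_H (A := A) (N := N) (M := M)).1
  obtain ⟨y, hy, hyH⟩ := (isGreatest_HJ hN hM hJ).1
  obtain ⟨x, hx⟩ := subPoly_nonempty hJ y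
  rw [mem_subPoly] at hx
  -- Off `J`, `b` is raised to keep `x` feasible; `b - y ≥ 0` still bounds the distance of `b` to
  -- the orthant by `M y ≤ 1`.
  let b : Fin m → ℝ := fun i => if i ∈ J then y i else max (y i) ((A *ᵥ x) i)
  have hxb : x ∈ poly A b := fun i => by
    by_cases hi : i ∈ J
    · simpa [b, hi] using hx i hi
    · simp [b, hi]
  have hyb : y ≤ b := fun i => by
    by_cases hi : i ∈ J <;> simp [b, hi]
  have hb : b ∈ (Set.range fun x : Fin n → ℝ => A *ᵥ x) + Set.Ici (0 : Fin m → ℝ) :=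
    ⟨_, ⟨x, rfl⟩, b - A *ᵥ x, Set.mem_Ici.2 (sub_nonneg.2 hxb), by simp⟩
  have hlow : H A N M ≤ dist N 0 (poly A b) := by
    obtain ⟨z, hz, hzN⟩ := exists_eq_dist hN (isClosed_poly b) ⟨x, hxb⟩ 0
    rw [← hzN, zero_sub, map_neg_eq_map, ← hJH, ← hyH]
    refine minNorm_le (mem_subPoly.2 fun i hi => ?_)
    simpa [b, hi] using hz i
  have hdist : dist M b (Set.Ici 0) ≤ 1 := by
    refine (dist_le (x := b - y) (sub_nonneg.2 hyb)).trans ?_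
    simpa using hy
  have hup := dist_poly_le hN hM ⟨x, hxb⟩ 0
  have hmul : H A N M * dist M b (Set.Ici 0) ≤ H A N M := mul_le_of_le_one_right hH.le hdist
  refine ⟨b, hb, 0, ?_⟩
  rw [Matrix.mulVec_zero, sub_zero] at hup ⊢
  exact ⟨le_antisymm hup (hmul.trans hlow), hH.trans_le (hlow.trans hup)⟩

end Constants

end Hoffman

theorem mainTheorem5 {m n : ℕ} (A : Matrix (Fin m) (Fin n) ℝ)
    (N : Seminorm ℝ (Fin n → ℝ)) (hN : ∀ x, N x = 0 → x = 0)
    (M : Seminorm ℝ (Fin m → ℝ)) (hM : ∀ y, M y = 0 → y = 0) :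
    -- the minima and maxima in the definition of `H_J(A)` and `H(A)` are attained
    ((∀ J ∈ Hoffman.surjSets A,
        (∀ y : Fin m → ℝ, IsLeast (N '' Hoffman.subPoly A J y) (Hoffman.minNorm A N J y)) ∧
        IsGreatest (Hoffman.minNorm A N J '' {y | M y ≤ 1}) (Hoffman.HJ A N M J)) ∧
      IsGreatest (Hoffman.HJ A N M '' Hoffman.surjSets A) (Hoffman.H A N M)) ∧
    -- the error bound, the distance to the nonempty polyhedron being attained
    (∀ b ∈ (Set.range fun x : Fin n → ℝ => A *ᵥ x) + Set.Ici (0 : Fin m → ℝ),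
      ∀ u : Fin n → ℝ,
        (∃ x ∈ Hoffman.poly A b, N (u - x) = Hoffman.dist N u (Hoffman.poly A b)) ∧
        Hoffman.dist N u (Hoffman.poly A b) ≤
          Hoffman.H A N M * Hoffman.dist M (b - A *ᵥ u) (Set.Ici 0) ∧
        Hoffman.H A N M * Hoffman.dist M (b - A *ᵥ u) (Set.Ici 0) ≤
          Hoffman.H A N M * M ((A *ᵥ u - b)⁺)) ∧
    -- tightness of the first bound
    (0 < Hoffman.H A N M →
      ∃ b ∈ (Set.range fun x : Fin n → ℝ => A *ᵥ x) + Set.Ici (0 : Fin m → ℝ),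
        ∃ u : Fin n → ℝ,
          Hoffman.dist N u (Hoffman.poly A b) =
            Hoffman.H A N M * Hoffman.dist M (b - A *ᵥ u) (Set.Ici 0) ∧
          0 < Hoffman.H A N M * Hoffman.dist M (b - A *ᵥ u) (Set.Ici 0)) := by
  refine ⟨⟨fun J hJ => ⟨fun y => ⟨Hoffman.exists_eq_minNorm hN hJ y, ?_⟩,
    Hoffman.isGreatest_HJ hN hM hJ⟩, Hoffman.isGreatest_H⟩, fun b hb u => ⟨?_, ?_, ?_⟩,
    Hoffman.exists_tight hN hM⟩
  · rintro _ ⟨x, hx, rfl⟩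
    exact Hoffman.minNorm_le hx
  · exact Hoffman.exists_eq_dist hN (Hoffman.isClosed_poly b) (Hoffman.poly_nonempty hb) u
  · exact Hoffman.dist_poly_le hN hM (Hoffman.poly_nonempty hb) u
  · refine mul_le_mul_of_nonneg_left ?_ Hoffman.H_nonneg
    rw [← neg_sub (A *ᵥ u) b]
    exact Hoffman.dist_nonneg_orthant_le M _
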